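/- There exists an absolute constant $C>0$ for which the following holds. Let $\mathcal X$ be a measurable space and let $\mathcal H\subseteq\{\pm1\}^{\mathcal X}$ be any class of measurable hypotheses of VC dimension $d$ (the largest size of a finite set $S\subseteq\mathcal X$ such that every function $S\to\{\pm1\}$ is the restriction to $S$ of some $h\in\mathcal H$). Let $\mu\in(0,1/2]$, and let $\mathcal D$ be any probability distribution over $\mathcal X\times[k]$ such that $\Pr_{(x,y)\sim\mathcal D}(y=i)\le\frac{10}{k}$ for every $i\in[k]$. Let $\phi:[k]\to\{\pm1\}$ be a random function sampled according to one of the following rules: (1) the values $\phi(i)$, $i\in[k]$, are independent and $\Pr(\phi(i)=-1)=\mu$ for each $i$; or (2) $\mu k$ is an integer and $\phi$ is chosen uniformly among all functions satisfying $|\{i\in[k]:\phi(i)=-1\}|=\mu k$. For each $\phi$, let $\mathcal D_\phi$ be the distribution of $(x,\phi(y))$ when $(x,y)\sim\mathcal D$. Then, for any $\nu>0$ and $\delta>0$, if $$k\ge C\cdot\frac{d+\ln(1/\delta)}{\nu^2},$$ then with probability at least $1-\delta$ over the choice of $\phi$, the approximation error $\inf_{h\in\mathcal H}\Pr_{(x,y)\sim\mathcal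 D_\phi}\bigl(h(x)\ne y\bigr)$ of $\mathcal H$ with respect to $\mathcal D_\phi$ is at least $\mu-\nu$. -/

import Mathlib

open MeasureTheory ProbabilityTheory

/-- The sigma-algebra on `{±1} = ℤˣ` is the discrete one. -/
instance intUnitsMeasurableSingletonClass : MeasurableSingletonClass ℤˣ where
  measurableSet_singleton u :=
    ⟨{(u : ℤ)}, MeasurableSet.of_discrete, by ext v; simp [Units.ext_iff]⟩

namespace BinaryClass

/-- The binary hypothesis class `H ⊆ {±1}^X` shatters the finite set `s`: every `±1`-labelling of
the points of `s` is realised by some hypothesis of `H`. -/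
def Shatters {X : Type*} (H : Set (X → ℤˣ)) (s : Finset X) : Prop :=
  ∀ f : X → ℤˣ, ∃ h ∈ H, ∀ x ∈ s, h x = f x

/-- `H` has VC dimension (exactly) `d`: the largest cardinality of a finite set shattered by `H`
exists and equals `d`. -/
def HasVCDim {X : Type*} (H : Set (X → ℤˣ)) (d : ℕ) : Prop :=
  IsGreatest {n : ℕ | ∃ s : Finset X, s.card = n ∧ Shatters H s} d

/-- The error `P_{(x,y) ∼ D}(h(x) ≠ y)` of the predictor `h` with respect to `D`. -/
noncomputable def err {X Y : Type*} [MeasurableSpace X] [MeasurableSpace Y]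
    (D : Measure (X × Y)) (h : X → Y) : ℝ :=
  D.real {z | h z.1 ≠ z.2}

/-- The approximation error `inf_{h ∈ H} err_D(h)` of the class `H` with respect to `D`. -/
noncomputable def approxErr {X Y : Type*} [MeasurableSpace X] [MeasurableSpace Y]
    (D : Measure (X × Y)) (H : Set (X → Y)) : ℝ :=
  ⨅ h : H, err D (h : X → Y)

/-- The distribution `D_φ` of `(x, φ(y))` when `(x, y) ∼ D`. -/
noncomputable def relabel {X : Type*} [MeasurableSpace X] {k : ℕ}
    (D : Measure (X × Fin k)) (φ : Fin k → ℤˣ) : Measure (X × ℤˣ) :=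
  D.map fun z => (z.1, φ z.2)

/-- The law of a random labelling `φ : [k] → {±1}` with independent coordinates and
`P(φ(i) = -1) = μ`, `P(φ(i) = 1) = 1 - μ` for every `i`. -/
noncomputable def iidLabeling (k : ℕ) (μ : unitInterval) : Measure (Fin k → ℤˣ) :=
  Measure.pi fun _ => bernoulliMeasure (-1 : ℤˣ) 1 μ

/-- The uniform law on the labellings `φ : [k] → {±1}` for which `|{i : φ(i) = -1}| = μ k`. -/
noncomputable def balancedLabeling (k : ℕ) (μ : unitInterval) : Measure (Fin k → ℤˣ) :=
  uniformOn {φ | ((Finset.univ.filter fun i => φ i = -1).card : ℝ) = (μ : ℝ) * k}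

end BinaryClass

/-!
For a labelling `φ`, the error of `h` under `D_φ` is linear in the indicators `𝟙[φ i = -1]`, with
coefficient `a i = E_D [h(x) 𝟙(y = i)]` at the label `i`, and its mean over `φ` is at least `μ`
because `μ ≤ 1/2`. So the error of `h` falls below `μ` by at most the centred linear statistic
`deficit`, and the theorem asks that its supremum over `H` be at most `ν` with probability `1 - δ`.

*Tails.* Both laws of `φ` satisfy `P (∀ i ∈ S, φ i = u) ≤ P (φ i = u) ^ |S|` for both values of `u`
(`NegDependent`). Expanding a product of Bernoulli factors shows that a linear statistic with
nonnegative weights then has at most the exponential moments of the independent case; splitting the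
weights into positive and negative parts makes every linear statistic sub-Gaussian with respect to
the Euclidean norm of the weights (`NegDependent.integral_exp_le`). From here on the two sampling
rules need not be distinguished.

*Metric entropy.* As no label has mass above `10 / k`, the squared Euclidean distance between the
weights of `h` and `g` is at most `(40 / k) P(h ≠ g)`. An `ε`-separated set of `N` hypotheses for
the distance `P(h ≠ g)` is distinguished by `2 log N / ε` well-chosen points, and the Sauer–Shelah
lemma gives `N ≤ exp (1/2) (4 / ε) ^ (2 d)` (`log_card_le_of_separated`).

*Chaining.* A union bound over a single net would lose a logarithmic factor in `k`. Instead, nets at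
the scales `4 ^ (-j)` are linked, each element of a net to a close one of the preceding net; the link
at level `j` is allowed a deviation of order `ν (j + 1) 2 ^ (-j)`, and these deviations sum to at most
`ν / 2` (`measureReal_exists_net_le`). The net at a small enough scale approximates the whole class
up to `ν / 2`, whatever `φ` is. The union bounds absorb their entropy into the term `d` of the
hypothesis on `k`, which needs `d ≥ 1`; for `d = 0` the class is a single hypothesis and the
Chernoff bound suffices.
-/

/-! ### Negatively correlated random labellings -/

/-- The labelling `φ` drawn from `P` takes the value `u` on any prescribed set `S` of coordinates
with probability at most `p ^ |S|`, as if its coordinates were independent with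
`P (φ i = u) = p`. This is the form of negative correlation that bounds exponential moments. -/
def NegCorrelated {k : ℕ} (P : Measure (Fin k → ℤˣ)) (u : ℤˣ) (p : ℝ) : Prop :=
  ∀ S : Finset (Fin k), P.real {φ | ∀ i ∈ S, φ i = u} ≤ p ^ S.card

/-- The indicator of `φ i = u`, as a real number. -/
def labelInd {k : ℕ} (u : ℤˣ) (φ : Fin k → ℤˣ) (i : Fin k) : ℝ := if φ i = u then 1 else 0

lemma labelInd_one {k : ℕ} (φ : Fin k → ℤˣ) (i : Fin k) :
    labelInd 1 φ i = 1 - labelInd (-1) φ i := by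
  rcases Int.units_eq_one_or (φ i) with h | h <;> simp [labelInd, h]

/-- Hoeffding's lemma for a Bernoulli variable. -/
lemma one_add_mul_exp_sub_one_le {p : ℝ} (hp0 : 0 ≤ p) (hp1 : p ≤ 1) (c : ℝ) :
    1 + p * (Real.exp c - 1) ≤ Real.exp (p * c + c ^ 2 / 8) := by
  have h := (hasSubgaussianMGF_of_mem_Icc (μ := bernoulliMeasure (1 : ℝ) 0 ⟨p, hp0, hp1⟩)
    (X := id) (a := 0) (b := 1) aemeasurable_id (by
      rw [bernoulliMeasure_def, ae_add_measure_iff]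
      constructor <;> refine Measure.ae_smul_measure ?_ _ <;> simp [ae_dirac_eq])).mgf_le c
  simp only [mgf, integral_bernoulliMeasure, id] at h
  simp only [smul_eq_mul, mul_one, mul_zero, add_zero, sub_zero, zero_sub, nnnorm_one] at h
  have e1 : 1 + p * (Real.exp c - 1)
      = (p * Real.exp (c * (1 - p)) + (1 - p) * Real.exp (c * -p)) * Real.exp (p * c) := by
    rw [add_mul, mul_assoc, mul_assoc, ← Real.exp_add, ← Real.exp_add]
    ring_nf
    simp
    ring
  rw [e1, Real.exp_add, mul_comm]
  refine mul_le_mul_of_nonneg_left (h.trans_eq ?_) (Real.exp_nonneg _)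
  congr 1
  push_cast
  ring

/-- For nonnegative weights, negative correlation lets the exponential moment of a weighted count
be bounded by that of independent labels: expanding `∏ (1 + (exp (c i) - 1) 𝟙[φ i = u])` gives
nonnegative multiples of the probabilities that `NegCorrelated` controls. -/
lemma NegCorrelated.integral_exp_le {k : ℕ} {P : Measure (Fin k → ℤˣ)} [IsProbabilityMeasure P]
    {u : ℤˣ} {p : ℝ} (h : NegCorrelated P u p) (hp0 : 0 ≤ p) (hp1 : p ≤ 1)
    (c : Fin k → ℝ) (hc : ∀ i, 0 ≤ c i) :
    ∫ φ, Real.exp (∑ i, c i * (labelInd u φ i - p)) ∂P ≤ Real.exp (∑ i, c i ^ 2 / 8) := by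
  have hexp : ∀ φ : Fin k → ℤˣ, Real.exp (∑ i, c i * labelInd u φ i)
      = ∑ S ∈ Finset.univ.powerset, (∏ i ∈ S, (Real.exp (c i) - 1)) *
          Set.indicator {φ : Fin k → ℤˣ | ∀ i ∈ S, φ i = u} (fun _ => (1 : ℝ)) φ := by
    intro φ
    have e : ∀ i, Real.exp (c i * labelInd u φ i)
        = 1 + (Real.exp (c i) - 1) * labelInd u φ i := by
      intro i; unfold labelInd; split_ifs <;> simp
    rw [Real.exp_sum, Finset.prod_congr rfl fun i _ => e i, Finset.prod_one_add]
    refine Finset.sum_congr rfl fun S _ => ?_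
    rw [Finset.prod_mul_distrib]
    congr 1
    simp only [labelInd, Set.indicator, Set.mem_ofPred_eq]
    split_ifs with hS
    · exact Finset.prod_eq_one fun i hi => if_pos (hS i hi)
    · push Not at hS
      obtain ⟨i, hi, hne⟩ := hS
      exact Finset.prod_eq_zero hi (if_neg hne)
  have hbd : ∫ φ, Real.exp (∑ i, c i * labelInd u φ i) ∂P
      ≤ Real.exp (∑ i, (p * c i + c i ^ 2 / 8)) := by
    simp_rw [hexp]
    rw [integral_finsetSum _ fun S _ => Integrable.of_finite]
    calc ∑ S ∈ Finset.univ.powerset, ∫ φ, (∏ i ∈ S, (Real.exp (c i) - 1)) *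
            Set.indicator {φ : Fin k → ℤˣ | ∀ i ∈ S, φ i = u} (fun _ => (1 : ℝ)) φ ∂P
        ≤ ∑ S ∈ Finset.univ.powerset, ∏ i ∈ S, (p * (Real.exp (c i) - 1)) := by
          refine Finset.sum_le_sum fun S _ => ?_
          rw [integral_const_mul, integral_indicator_const _ (MeasurableSet.of_discrete),
            Finset.prod_mul_distrib, Finset.prod_const, mul_comm, smul_eq_mul, mul_one]
          exact mul_le_mul_of_nonneg_right (h S)
            (Finset.prod_nonneg fun i _ => by linarith [Real.one_le_exp (hc i)])
      _ = ∏ i, (1 + p * (Real.exp (c i) - 1)) := (Finset.prod_one_add _).symm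
      _ ≤ ∏ i, Real.exp (p * c i + c i ^ 2 / 8) :=
          Finset.prod_le_prod (fun i _ => add_nonneg zero_le_one
            (mul_nonneg hp0 (by linarith [Real.one_le_exp (hc i)])))
            fun i _ => one_add_mul_exp_sub_one_le hp0 hp1 (c i)
      _ = _ := (Real.exp_sum _ _).symm
  have e2 : ∀ φ : Fin k → ℤˣ, Real.exp (∑ i, c i * (labelInd u φ i - p))
      = Real.exp (-∑ i, p * c i) * Real.exp (∑ i, c i * labelInd u φ i) := by
    intro φ
    rw [← Real.exp_add, ← Finset.sum_neg_distrib, ← Finset.sum_add_distrib]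
    congr 1
    exact Finset.sum_congr rfl fun i _ => by ring
  simp_rw [e2]
  rw [integral_const_mul]
  refine (mul_le_mul_of_nonneg_left hbd (Real.exp_nonneg _)).trans_eq ?_
  rw [← Real.exp_add, Finset.sum_add_distrib]
  congr 1
  ring

/-- The events `φ i = -1`, and likewise the events `φ i = 1`, are negatively correlated, at the
levels `p` and `1 - p`. Both halves are needed to control weights of both signs. -/
structure NegDependent {k : ℕ} (P : Measure (Fin k → ℤˣ)) (p : ℝ) : Prop where
  nonneg : 0 ≤ p
  le_one : p ≤ 1
  neg : NegCorrelated P (-1) p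
  pos : NegCorrelated P 1 (1 - p)

/-- A linear statistic of negatively dependent labels is sub-Gaussian with respect to the
Euclidean norm of its weights. -/
lemma NegDependent.integral_exp_le {k : ℕ} {P : Measure (Fin k → ℤˣ)} [IsProbabilityMeasure P]
    {p : ℝ} (h : NegDependent P p) (a : Fin k → ℝ) :
    ∫ φ, Real.exp (∑ i, a i * (labelInd (-1) φ i - p)) ∂P ≤ Real.exp (∑ i, a i ^ 2 / 2) := by
  -- Positive weights act on the labels `-1`, negative ones on the labels `1`.
  have h1 := h.neg.integral_exp_le h.nonneg h.le_one (fun i => 2 * (a i)⁺)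
    fun i => by positivity
  have h2 := h.pos.integral_exp_le (sub_nonneg.2 h.le_one) (by linarith [h.nonneg])
    (fun i => 2 * (a i)⁻) fun i => by positivity
  have hsq : ∀ i, (2 * (a i)⁺) ^ 2 / 8 ≤ a i ^ 2 / 2 ∧ (2 * (a i)⁻) ^ 2 / 8 ≤ a i ^ 2 / 2 := by
    intro i
    rcases le_total 0 (a i) with ha | ha
    · rw [posPart_eq_self.2 ha, negPart_eq_zero.2 ha]
      constructor <;> nlinarith [sq_nonneg (a i)]
    · rw [posPart_eq_zero.2 ha, negPart_eq_neg.2 ha]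
      constructor <;> nlinarith [sq_nonneg (a i)]
  replace h1 := h1.trans (Real.exp_le_exp.2 (Finset.sum_le_sum fun i _ => (hsq i).1))
  replace h2 := h2.trans (Real.exp_le_exp.2 (Finset.sum_le_sum fun i _ => (hsq i).2))
  have key : ∀ φ : Fin k → ℤˣ, Real.exp (∑ i, a i * (labelInd (-1) φ i - p))
      ≤ (Real.exp (∑ i, 2 * (a i)⁺ * (labelInd (-1) φ i - p))
        + Real.exp (∑ i, 2 * (a i)⁻ * (labelInd 1 φ i - (1 - p)))) / 2 := by
    intro φ
    set A := ∑ i, (a i)⁺ * (labelInd (-1) φ i - p)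
    set B := ∑ i, (a i)⁻ * (labelInd 1 φ i - (1 - p))
    have eA : ∑ i, 2 * (a i)⁺ * (labelInd (-1) φ i - p) = A + A := by
      rw [← two_mul, Finset.mul_sum]; exact Finset.sum_congr rfl fun i _ => by ring
    have eB : ∑ i, 2 * (a i)⁻ * (labelInd 1 φ i - (1 - p)) = B + B := by
      rw [← two_mul, Finset.mul_sum]; exact Finset.sum_congr rfl fun i _ => by ring
    have eAB : ∑ i, a i * (labelInd (-1) φ i - p) = A + B := by
      rw [← Finset.sum_add_distrib]
      refine Finset.sum_congr rfl fun i _ => ?_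
      nth_rewrite 1 [← posPart_sub_negPart (a i)]
      rw [labelInd_one]
      ring
    rw [eA, eB, eAB, Real.exp_add, Real.exp_add, Real.exp_add]
    nlinarith [sq_nonneg (Real.exp A - Real.exp B)]
  calc _ ≤ ∫ φ, (Real.exp (∑ i, 2 * (a i)⁺ * (labelInd (-1) φ i - p))
        + Real.exp (∑ i, 2 * (a i)⁻ * (labelInd 1 φ i - (1 - p)))) / 2 ∂P :=
        integral_mono Integrable.of_finite Integrable.of_finite key
    _ ≤ _ := by
        rw [integral_div, integral_add Integrable.of_finite Integrable.of_finite]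
        linarith

/-- The Chernoff bound for a linear statistic of negatively dependent labels. -/
lemma NegDependent.measureReal_le_sum {k : ℕ} {P : Measure (Fin k → ℤˣ)}
    [IsProbabilityMeasure P] {p : ℝ} (h : NegDependent P p) (a : Fin k → ℝ) {v t : ℝ}
    (hv : 0 < v) (ha : ∑ i, a i ^ 2 ≤ v) (ht : 0 ≤ t) :
    P.real {φ | t ≤ ∑ i, a i * (labelInd (-1) φ i - p)} ≤ Real.exp (-(t ^ 2 / (2 * v))) := by
  refine (measure_ge_le_exp_mul_mgf t (t := t / v) (by positivity)
    Integrable.of_finite).trans ?_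
  have hm : mgf (fun φ : Fin k → ℤˣ => ∑ i, a i * (labelInd (-1) φ i - p)) P (t / v)
      ≤ Real.exp ((t / v) ^ 2 * v / 2) := by
    have := h.integral_exp_le fun i => t / v * a i
    simp only [mgf, Finset.mul_sum, ← mul_assoc]
    refine this.trans (Real.exp_le_exp.2 ?_)
    rw [← Finset.sum_div]
    simp_rw [mul_pow]
    rw [← Finset.mul_sum]
    gcongr
  refine (mul_le_mul_of_nonneg_left hm (Real.exp_nonneg _)).trans_eq ?_
  rw [← Real.exp_add]
  congr 1
  field_simp
  ring

/-! ### The two random labellings are negatively dependent -/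

namespace BinaryClass

instance (k : ℕ) (μ : unitInterval) : IsProbabilityMeasure (iidLabeling k μ) := by
  unfold iidLabeling; infer_instance

lemma negDependent_iidLabeling (k : ℕ) (μ : unitInterval) :
    NegDependent (iidLabeling k μ) μ := by
  have key : ∀ (u : ℤˣ) (q : ℝ), (bernoulliMeasure (-1 : ℤˣ) 1 μ).real {u} = q →
      NegCorrelated (iidLabeling k μ) u q := by
    intro u q hq S
    have hset : {φ : Fin k → ℤˣ | ∀ i ∈ S, φ i = u}
        = Set.univ.pi fun i => if i ∈ S then {u} else Set.univ := by
      ext φ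
      simp only [Set.mem_ofPred_eq, Set.mem_pi, Set.mem_univ, true_implies]
      refine forall_congr' fun i => ?_
      split_ifs with hi <;> simp [hi]
    rw [hset, iidLabeling, measureReal_def, Measure.pi_pi, ENNReal.toReal_prod]
    refine le_of_eq ?_
    rw [← Finset.prod_const, ← Finset.prod_subset (Finset.subset_univ S)]
    · refine Finset.prod_congr rfl fun i hi => ?_
      rw [if_pos hi, ← hq, measureReal_def]
    · intro i _ hi
      simp [hi]
  have h1 : (1 : ℤˣ) ≠ -1 := by decide
  refine ⟨μ.2.1, μ.2.2, key _ _ ?_, key _ _ ?_⟩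
  · rw [bernoulliMeasure_real_apply _ (MeasurableSet.of_discrete)]
    simp [h1]
  · rw [bernoulliMeasure_real_apply _ (MeasurableSet.of_discrete)]
    simp [h1.symm]

end BinaryClass

lemma choose_sub_mul_pow_le {k j s : ℕ} (hsj : s ≤ j) (hjk : j ≤ k) :
    (k - s).choose (j - s) * k ^ s ≤ k.choose j * j ^ s := by
  induction s with
  | zero => simp
  | succ s ih =>
    obtain ⟨b, rfl⟩ : ∃ b, j = s + 1 + b := ⟨j - (s + 1), by omega⟩
    obtain ⟨a, rfl⟩ : ∃ a, k = s + 1 + a := ⟨k - (s + 1), by omega⟩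
    have ih' := ih (by omega)
    have e1 : s + 1 + a - s = a + 1 := by omega
    have e2 : s + 1 + b - s = b + 1 := by omega
    rw [e1, e2] at ih'
    rw [Nat.add_sub_cancel_left, Nat.add_sub_cancel_left]
    have hch := Nat.add_one_mul_choose_eq a b
    have hab : b ≤ a := by omega
    have step : a.choose b * (s + 1 + a) ≤ (a + 1).choose (b + 1) * (s + 1 + b) := by
      refine le_of_mul_le_mul_left ?_ (show 0 < a + 1 from Nat.succ_pos a)
      calc (a + 1) * (a.choose b * (s + 1 + a))
          = (a + 1).choose (b + 1) * ((b + 1) * (s + 1 + a)) := by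
            rw [← mul_assoc, hch, mul_assoc]
        _ ≤ (a + 1).choose (b + 1) * ((a + 1) * (s + 1 + b)) :=
            Nat.mul_le_mul_left _ (by nlinarith)
        _ = _ := by ring
    calc a.choose b * (s + 1 + a) ^ (s + 1)
        = a.choose b * (s + 1 + a) * (s + 1 + a) ^ s := by ring
      _ ≤ (a + 1).choose (b + 1) * (s + 1 + b) * (s + 1 + a) ^ s := Nat.mul_le_mul_right _ step
      _ = (a + 1).choose (b + 1) * (s + 1 + a) ^ s * (s + 1 + b) := by ring
      _ ≤ (s + 1 + a).choose (s + 1 + b) * (s + 1 + b) ^ s * (s + 1 + b) :=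
          Nat.mul_le_mul_right _ ih'
      _ = _ := by ring

lemma units_eq_iff_of_eq_iff {u a b : ℤˣ} (h : a = u ↔ b = u) : a = b := by
  rcases Int.units_eq_one_or a with rfl | rfl <;> rcases Int.units_eq_one_or b with rfl | rfl <;>
    rcases Int.units_eq_one_or u with rfl | rfl <;> first | rfl | (revert h; decide)

lemma choose_le_card_labelings (k j : ℕ) (u : ℤˣ) :
    k.choose j ≤ (Finset.univ.filter fun φ : Fin k → ℤˣ =>
      (Finset.univ.filter fun i => φ i = u).card = j).card := by
  have hne : -u ≠ u := by rcases Int.units_eq_one_or u with rfl | rfl <;> decide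
  have hfil : ∀ A : Finset (Fin k),
      (Finset.univ.filter fun i => (if i ∈ A then u else -u) = u) = A := by
    intro A; ext i; by_cases hi : i ∈ A <;> simp [hi, hne]
  calc k.choose j = ((Finset.univ : Finset (Fin k)).powersetCard j).card := by simp
    _ ≤ _ := Finset.card_le_card_of_injOn
      (fun (A : Finset (Fin k)) i => if i ∈ A then u else -u)
      (fun A hA => by
        simp only [Finset.coe_filter, Finset.mem_univ, true_and, Set.mem_ofPred_eq, hfil]
        exact (Finset.mem_powersetCard.1 hA).2)
      (fun A _ B _ hAB => by
        rw [← hfil A, ← hfil B]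
        exact Finset.filter_congr fun i _ => by
          have := congrFun hAB i
          simp only at this
          rw [this])

lemma card_labelings_le_choose {k j : ℕ} (u : ℤˣ) (S : Finset (Fin k)) :
    (Finset.univ.filter fun φ : Fin k → ℤˣ =>
      (Finset.univ.filter fun i => φ i = u).card = j ∧ ∀ i ∈ S, φ i = u).card
      ≤ (k - S.card).choose (j - S.card) := by
  calc _ ≤ (Sᶜ.powersetCard (j - S.card)).card := Finset.card_le_card_of_injOn
        (fun (φ : Fin k → ℤˣ) => (Finset.univ.filter fun i => φ i = u) \ S) ?_ ?_
    _ = _ := by rw [Finset.card_powersetCard, Finset.card_compl, Fintype.card_fin]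
  · intro φ hφ
    obtain ⟨h1, h2⟩ := (Finset.mem_filter.1 hφ).2
    rw [Finset.mem_coe, Finset.mem_powersetCard]
    refine ⟨fun i hi => by simpa using (Finset.mem_sdiff.1 hi).2, ?_⟩
    rw [Finset.card_sdiff_of_subset fun i hi => by simpa using h2 i hi, h1]
  · intro φ hφ ψ hψ h
    obtain ⟨_, h2⟩ := (Finset.mem_filter.1 hφ).2
    obtain ⟨_, h3⟩ := (Finset.mem_filter.1 hψ).2
    funext i
    by_cases hi : i ∈ S
    · rw [h2 i hi, h3 i hi]
    · refine units_eq_iff_of_eq_iff (u := u) ?_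
      have := congrArg (i ∈ ·) h
      simpa [hi] using this

/-- A uniform labelling with exactly `j` labels `u` is negatively correlated for `u`. -/
lemma negCorrelated_uniformOn {k j : ℕ} (u : ℤˣ) (hk : 0 < k) (hj : j ≤ k) :
    NegCorrelated (uniformOn {φ : Fin k → ℤˣ | (Finset.univ.filter fun i => φ i = u).card = j})
      u (j / k) := by
  intro S
  set N := Finset.univ.filter fun φ : Fin k → ℤˣ =>
      (Finset.univ.filter fun i => φ i = u).card = j
  have hN : {φ : Fin k → ℤˣ | (Finset.univ.filter fun i => φ i = u).card = j} = (N : Set _) := by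
    ext; simp [N]
  have hT : {φ : Fin k → ℤˣ | ∀ i ∈ S, φ i = u}
      = ((Finset.univ.filter fun φ : Fin k → ℤˣ => ∀ i ∈ S, φ i = u) : Finset _) := by
    ext; simp
  rw [hN, hT, measureReal_def, uniformOn_apply_finset, ENNReal.toReal_div, ENNReal.toReal_natCast,
    ENNReal.toReal_natCast]
  have hpos : 0 < N.card := (Nat.choose_pos hj).trans_le (choose_le_card_labelings k j u)
  have hk' : (0 : ℝ) < k := by exact_mod_cast hk
  rw [div_pow, div_le_div_iff₀ (by exact_mod_cast hpos) (by positivity)]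
  have hint : N ∩ (Finset.univ.filter fun φ : Fin k → ℤˣ => ∀ i ∈ S, φ i = u)
      = Finset.univ.filter fun φ : Fin k → ℤˣ =>
        (Finset.univ.filter fun i => φ i = u).card = j ∧ ∀ i ∈ S, φ i = u := by
    rw [Finset.filter_and]
  rw [hint]
  have main : (Finset.univ.filter fun φ : Fin k → ℤˣ =>
        (Finset.univ.filter fun i => φ i = u).card = j ∧ ∀ i ∈ S, φ i = u).card * k ^ S.card
      ≤ j ^ S.card * N.card := by
    rcases le_or_gt S.card j with hS | hS
    · calc _ ≤ (k - S.card).choose (j - S.card) * k ^ S.card :=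
            Nat.mul_le_mul_right _ (card_labelings_le_choose u S)
        _ ≤ k.choose j * j ^ S.card := choose_sub_mul_pow_le hS hj
        _ ≤ N.card * j ^ S.card := Nat.mul_le_mul_right _ (choose_le_card_labelings k j u)
        _ = _ := mul_comm _ _
    · rw [Finset.card_eq_zero.2, zero_mul]
      · exact Nat.zero_le _
      · refine Finset.filter_eq_empty_iff.2 fun φ _ ⟨h1, h2⟩ => ?_
        have := Finset.card_le_card (s := S) (t := Finset.univ.filter fun i => φ i = u)
          fun i hi => by simpa using h2 i hi
        omega
  exact_mod_cast main

namespace BinaryClass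

lemma balancedLabeling_eq {k j : ℕ} {μ : unitInterval} (hj : (j : ℝ) = μ * k) :
    balancedLabeling k μ
      = uniformOn {φ : Fin k → ℤˣ | (Finset.univ.filter fun i => φ i = -1).card = j} := by
  unfold balancedLabeling
  rw [← hj]
  simp only [Nat.cast_inj]

lemma isProbabilityMeasure_balancedLabeling {k j : ℕ} {μ : unitInterval}
    (hj : (j : ℝ) = μ * k) : IsProbabilityMeasure (balancedLabeling k μ) := by
  have hjk : j ≤ k := by
    have : (j : ℝ) ≤ k := hj ▸ mul_le_of_le_one_left (Nat.cast_nonneg k) μ.2.2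
    exact_mod_cast this
  rw [balancedLabeling_eq hj]
  refine isProbabilityMeasure_uniformOn (Set.toFinite _) ?_
  obtain ⟨φ, hφ⟩ := Finset.card_pos.1
    ((Nat.choose_pos hjk).trans_le (choose_le_card_labelings k j (-1)))
  exact ⟨φ, (Finset.mem_filter.1 hφ).2⟩

lemma negDependent_balancedLabeling {k j : ℕ} {μ : unitInterval} (hk : 0 < k)
    (hj : (j : ℝ) = μ * k) : NegDependent (balancedLabeling k μ) μ := by
  have hk' : (0 : ℝ) < k := by exact_mod_cast hk
  have hjk : j ≤ k := by
    have : (j : ℝ) ≤ k := hj ▸ mul_le_of_le_one_left hk'.le μ.2.2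
    exact_mod_cast this
  have hμ : (μ : ℝ) = j / k := by rw [hj]; field_simp
  rw [balancedLabeling_eq hj]
  refine ⟨μ.2.1, μ.2.2, hμ ▸ negCorrelated_uniformOn (-1) hk hjk, ?_⟩
  have hset : {φ : Fin k → ℤˣ | (Finset.univ.filter fun i => φ i = -1).card = j}
      = {φ : Fin k → ℤˣ | (Finset.univ.filter fun i => φ i = 1).card = k - j} := by
    ext φ
    have hadd := Finset.card_filter_add_card_filter_not (s := Finset.univ) fun i => φ i = 1
    have hfil : (Finset.univ.filter fun i => ¬ φ i = 1)
        = Finset.univ.filter fun i => φ i = -1 :=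
      Finset.filter_congr fun i _ => Int.units_ne_iff_eq_neg
    rw [hfil, Finset.card_univ, Fintype.card_fin] at hadd
    simp only [Set.mem_ofPred_eq]
    omega
  have h1 : 1 - (μ : ℝ) = ((k - j : ℕ) : ℝ) / k := by
    rw [Nat.cast_sub hjk, hμ]; field_simp
  rw [hset, h1]
  exact negCorrelated_uniformOn 1 hk (Nat.sub_le k j)

end BinaryClass

namespace BinaryClass

/-! ### Packing numbers of VC classes -/

/-- The probability under `P` that two hypotheses disagree. -/
noncomputable def disagree {X : Type*} [MeasurableSpace X] (P : Measure X) (f g : X → ℤˣ) : ℝ :=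
  P.real {x | f x ≠ g x}

/-- The Sauer–Shelah bound, with the binomial sum replaced by its exponential majorant: hypotheses
of a class that shatters no set of more than `d` points, distinguished by their values on `T`, are
at most `t ^ (-d) * (1 + t) ^ |T|` in number. -/
lemma card_mul_pow_le {X : Type*} {H : Set (X → ℤˣ)} {d : ℕ}
    (hd : ∀ s : Finset X, Shatters H s → s.card ≤ d) (F : Finset (X → ℤˣ)) (hF : ∀ f ∈ F, f ∈ H)
    (T : Finset X) (hT : ∀ f ∈ F, ∀ g ∈ F, (∀ x ∈ T, f x = g x) → f = g) {t : ℝ}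
    (ht0 : 0 < t) (ht1 : t ≤ 1) :
    (F.card : ℝ) * t ^ d ≤ (1 + t) ^ T.card := by
  classical
  set 𝒜 : Finset (Finset X) := F.image fun f => T.filter fun x => f x = 1
  have hcard : 𝒜.card = F.card := by
    refine Finset.card_image_of_injOn fun f hf g hg hfg => hT f hf g hg fun x hx => ?_
    refine units_eq_iff_of_eq_iff (u := 1) ?_
    have := congrArg (x ∈ ·) hfg
    simpa [hx] using this
  have hsh : ∀ s ∈ 𝒜.shatterer, s ⊆ T ∧ s.card ≤ d := by
    intro s hs
    rw [Finset.mem_shatterer] at hs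
    constructor
    · obtain ⟨u, hu, hsu⟩ := hs.exists_superset
      obtain ⟨f, _, rfl⟩ := Finset.mem_image.1 hu
      exact hsu.trans (Finset.filter_subset _ _)
    · refine hd s fun φ => ?_
      obtain ⟨u, hu, hsu⟩ := hs (Finset.filter_subset (fun x => φ x = 1) s)
      obtain ⟨w, hw, hsw⟩ := hs.exists_superset
      obtain ⟨f', _, rfl⟩ := Finset.mem_image.1 hw
      obtain ⟨f, hf, rfl⟩ := Finset.mem_image.1 hu
      refine ⟨f, hF f hf, fun x hx => units_eq_iff_of_eq_iff (u := 1) ?_⟩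
      have hxT : x ∈ T := (Finset.mem_filter.1 (hsw hx)).1
      have := congrArg (x ∈ ·) hsu
      simpa [hx, hxT] using this
  have hpow : ∑ s ∈ T.powerset, t ^ s.card = (1 + t) ^ T.card := by
    have := Finset.sum_pow_mul_eq_add_pow t 1 T
    simpa [add_comm] using this
  calc (F.card : ℝ) * t ^ d ≤ (𝒜.shatterer.card : ℝ) * t ^ d := by
        rw [← hcard]
        exact mul_le_mul_of_nonneg_right (Nat.cast_le.2 𝒜.card_le_card_shatterer) (by positivity)
    _ = ∑ _s ∈ 𝒜.shatterer, t ^ d := by rw [Finset.sum_const, nsmul_eq_mul]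
    _ ≤ ∑ s ∈ 𝒜.shatterer, t ^ s.card :=
        Finset.sum_le_sum fun s hs => pow_le_pow_of_le_one ht0.le ht1 (hsh s hs).2
    _ ≤ ∑ s ∈ T.powerset, t ^ s.card :=
        Finset.sum_le_sum_of_subset_of_nonneg
          (fun s hs => Finset.mem_powerset.2 (hsh s hs).1) fun _ _ _ => by positivity
    _ = _ := hpow

/-- Random points distinguish separated hypotheses: some `m` points leave at most a fraction
`(1 - ε) ^ m` of the given pairs undistinguished. The points are found one at a time, by
averaging. -/
lemma exists_finset_card_agree_le {X : Type*} [MeasurableSpace X] (P : Measure X)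
    [IsProbabilityMeasure P] {ε : ℝ} (hε1 : ε ≤ 1) (A : Finset ((X → ℤˣ) × (X → ℤˣ)))
    (hmeas : ∀ q ∈ A, Measurable q.1 ∧ Measurable q.2)
    (hsep : ∀ q ∈ A, ε ≤ disagree P q.1 q.2) (m : ℕ) :
    ∃ T : Finset X, T.card ≤ m ∧
      ((A.filter fun q => ∀ x ∈ T, q.1 x = q.2 x).card : ℝ) ≤ A.card * (1 - ε) ^ m := by
  classical
  induction m with
  | zero => exact ⟨∅, by simp, by simp⟩
  | succ m ih =>
    obtain ⟨T, hTm, hT⟩ := ih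
    set B := A.filter fun q => ∀ x ∈ T, q.1 x = q.2 x
    have hms : ∀ q ∈ B, MeasurableSet {x | q.1 x = q.2 x} := fun q hq =>
      measurableSet_eq_fun (hmeas q (Finset.mem_filter.1 hq).1).1
        (hmeas q (Finset.mem_filter.1 hq).1).2
    have hint : ∀ q ∈ B, Integrable
        (Set.indicator {x | q.1 x = q.2 x} fun _ => (1 : ℝ)) P := fun q hq =>
      (integrable_const _).indicator (hms q hq)
    obtain ⟨x, hx⟩ := exists_le_integral (integrable_finsetSum B hint)
    rw [integral_finsetSum B hint] at hx
    have hxl : ∑ q ∈ B, Set.indicator {x | q.1 x = q.2 x} (fun _ => (1 : ℝ)) x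
        = ((B.filter fun q => q.1 x = q.2 x).card : ℝ) := by
      simp [Set.indicator]
    have hxr : ∑ q ∈ B, ∫ x, Set.indicator {x | q.1 x = q.2 x} (fun _ => (1 : ℝ)) x ∂P
        ≤ B.card * (1 - ε) := by
      rw [← nsmul_eq_mul, ← Finset.sum_const]
      refine Finset.sum_le_sum fun q hq => ?_
      rw [integral_indicator_const _ (hms q hq), smul_eq_mul, mul_one]
      have h1 := hsep q (Finset.mem_filter.1 hq).1
      have h2 := probReal_compl_eq_one_sub (μ := P) (hms q hq)
      have h3 : {x | q.1 x = q.2 x}ᶜ = {x | q.1 x ≠ q.2 x} := rfl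
      rw [h3] at h2
      unfold disagree at h1
      linarith
    refine ⟨insert x T, (Finset.card_insert_le _ _).trans (by omega), ?_⟩
    have hfil : (A.filter fun q => ∀ y ∈ insert x T, q.1 y = q.2 y)
        = B.filter fun q => q.1 x = q.2 x := by
      ext q
      simp only [B, Finset.mem_filter, Finset.forall_mem_insert]
      tauto
    rw [hfil, ← hxl]
    calc _ ≤ (B.card : ℝ) * (1 - ε) := hx.trans hxr
      _ ≤ A.card * (1 - ε) ^ m * (1 - ε) := mul_le_mul_of_nonneg_right hT (by linarith)
      _ = _ := by ring

/-- An `ε`-separated subset of a class that shatters no set of more than `d` points has at most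
`exp (1/2) * (4 / ε) ^ (2 d)` elements. With `N` the number of hypotheses, `2 log N / ε` points
distinguish them all, and the Sauer–Shelah bound for that many points, with parameter `ε / 4`,
reads `log N ≤ d log (4 / ε) + (log N) / 2 + ε / 4`. -/
lemma log_card_le_of_separated {X : Type*} [MeasurableSpace X] (P : Measure X)
    [IsProbabilityMeasure P] {H : Set (X → ℤˣ)} (hmeas : ∀ h ∈ H, Measurable h) {d : ℕ}
    (hd : ∀ s : Finset X, Shatters H s → s.card ≤ d) {ε : ℝ} (hε0 : 0 < ε) (hε1 : ε ≤ 1)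
    (F : Finset (X → ℤˣ)) (hF : ∀ f ∈ F, f ∈ H)
    (hsep : ∀ f ∈ F, ∀ g ∈ F, f ≠ g → ε ≤ disagree P f g) :
    Real.log F.card ≤ 1 / 2 + 2 * d * Real.log (4 / ε) := by
  classical
  have hlog4 : 0 ≤ Real.log (4 / ε) := Real.log_nonneg (by rw [le_div_iff₀ hε0]; linarith)
  rcases F.eq_empty_or_nonempty with rfl | hne
  · simp; positivity
  have hN1 : (1 : ℝ) ≤ F.card := by exact_mod_cast hne.card_pos
  have hN0 : (0 : ℝ) < F.card := by linarith
  set N : ℝ := (F.card : ℝ)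
  have hlogN : 0 ≤ Real.log N := Real.log_nonneg hN1
  set m := ⌈2 * Real.log N / ε⌉₊
  have hm1 : 2 * Real.log N / ε ≤ m := Nat.le_ceil _
  have hm2 : (m : ℝ) ≤ 2 * Real.log N / ε + 1 := (Nat.ceil_lt_add_one (by positivity)).le
  obtain ⟨T, hTm, hT⟩ := exists_finset_card_agree_le P hε1 F.offDiag
    (fun q hq => ⟨hmeas _ (hF _ (Finset.mem_offDiag.1 hq).1),
      hmeas _ (hF _ (Finset.mem_offDiag.1 hq).2.1)⟩)
    (fun q hq => hsep _ (Finset.mem_offDiag.1 hq).1 _ (Finset.mem_offDiag.1 hq).2.1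
      (Finset.mem_offDiag.1 hq).2.2) m
  -- Fewer than one pair is left undistinguished by `T`.
  have hlt : ((F.offDiag.filter fun q => ∀ x ∈ T, q.1 x = q.2 x).card : ℝ) < 1 := by
    have hoff : (F.offDiag.card : ℝ) < N ^ 2 := by
      have h1 : F.offDiag.card < F.card ^ 2 := by
        rw [Finset.offDiag_card, sq]
        have := hne.card_pos
        have := Nat.mul_pos this this
        omega
      have h2 : (F.offDiag.card : ℝ) < ((F.card ^ 2 : ℕ) : ℝ) := Nat.cast_lt.2 h1
      rwa [Nat.cast_pow] at h2
    have hpow : (1 - ε) ^ m ≤ (N ^ 2)⁻¹ := by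
      calc (1 - ε) ^ m ≤ Real.exp (-ε) ^ m :=
            pow_le_pow_left₀ (by linarith) (Real.one_sub_le_exp_neg ε) m
        _ = Real.exp (-(ε * m)) := by rw [← Real.exp_nat_mul]; ring_nf
        _ ≤ Real.exp (-(2 * Real.log N)) := by
            refine Real.exp_le_exp.2 (neg_le_neg ?_)
            rw [div_le_iff₀ hε0] at hm1
            linarith
        _ = (N ^ 2)⁻¹ := by
            rw [Real.exp_neg, two_mul, Real.exp_add, Real.exp_log hN0, sq]
    calc _ ≤ (F.offDiag.card : ℝ) * (1 - ε) ^ m := hT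
      _ ≤ F.offDiag.card * (N ^ 2)⁻¹ := by gcongr
      _ < N ^ 2 * (N ^ 2)⁻¹ := by gcongr
      _ = 1 := mul_inv_cancel₀ (by positivity)
  have hzero : (F.offDiag.filter fun q => ∀ x ∈ T, q.1 x = q.2 x) = ∅ := by
    rw [← Finset.card_eq_zero]
    have : (F.offDiag.filter fun q => ∀ x ∈ T, q.1 x = q.2 x).card < 1 := by exact_mod_cast hlt
    omega
  have hinj : ∀ f ∈ F, ∀ g ∈ F, (∀ x ∈ T, f x = g x) → f = g := by
    intro f hf g hg hfg
    by_contra hne'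
    have : (f, g) ∈ F.offDiag.filter fun q => ∀ x ∈ T, q.1 x = q.2 x :=
      Finset.mem_filter.2 ⟨Finset.mem_offDiag.2 ⟨hf, hg, hne'⟩, hfg⟩
    rw [hzero] at this
    exact absurd this (Finset.notMem_empty _)
  have hε4 : 0 < ε / 4 := by positivity
  have hSS := card_mul_pow_le hd F hF T hinj hε4 (by linarith)
  have hle : N * (ε / 4) ^ d ≤ Real.exp (ε / 4 * m) := by
    calc N * (ε / 4) ^ d ≤ (1 + ε / 4) ^ T.card := hSS
      _ ≤ (1 + ε / 4) ^ m := pow_le_pow_right₀ (by linarith) hTm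
      _ ≤ Real.exp (ε / 4) ^ m :=
          pow_le_pow_left₀ (by linarith) (by linarith [Real.add_one_le_exp (ε / 4)]) m
      _ = Real.exp (ε / 4 * m) := by rw [← Real.exp_nat_mul]; ring_nf
  have hlog := Real.log_le_log (by positivity) hle
  rw [Real.log_exp, Real.log_mul hN0.ne' (by positivity), Real.log_pow] at hlog
  have hinv : Real.log (ε / 4) = -Real.log (4 / ε) := by
    rw [← Real.log_inv, inv_div]
  rw [hinv] at hlog
  have hεm : ε / 4 * m ≤ Real.log N / 2 + ε / 4 := by
    calc ε / 4 * m ≤ ε / 4 * (2 * Real.log N / ε + 1) := by gcongr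
      _ = _ := by field_simp; ring
  linarith

/-- A class of VC dimension at most `d` has finite `ε`-nets in itself, of the size that bounds its
packings. -/
lemma exists_net {X : Type*} [MeasurableSpace X] (P : Measure X)
    [IsProbabilityMeasure P] {H : Set (X → ℤˣ)} (hmeas : ∀ h ∈ H, Measurable h) {d : ℕ}
    (hd : ∀ s : Finset X, Shatters H s → s.card ≤ d) {ε : ℝ} (hε0 : 0 < ε) (hε1 : ε ≤ 1) :
    ∃ F : Finset (X → ℤˣ), (∀ f ∈ F, f ∈ H) ∧
      Real.log F.card ≤ 1 / 2 + 2 * d * Real.log (4 / ε) ∧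
      ∀ h ∈ H, ∃ f ∈ F, disagree P h f ≤ ε := by
  classical
  set M := Real.exp (1 / 2 + 2 * d * Real.log (4 / ε))
  let Sep : ℕ → Prop := fun n => ∃ F : Finset (X → ℤˣ), F.card = n ∧ (∀ f ∈ F, f ∈ H) ∧
    ∀ f ∈ F, ∀ g ∈ F, f ≠ g → ε ≤ disagree P f g
  have hbound : ∀ n, Sep n → n ≤ ⌊M⌋₊ := by
    rintro n ⟨F, rfl, hF, hsep⟩
    have := log_card_le_of_separated P hmeas hd hε0 hε1 F hF hsep
    rcases F.eq_empty_or_nonempty with rfl | hne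
    · simp
    · exact Nat.le_floor ((Real.log_le_iff_le_exp (by exact_mod_cast hne.card_pos)).1 this)
  have h0 : Sep 0 := ⟨∅, by simp⟩
  obtain ⟨F, hcard, hF, hsep⟩ : Sep (Nat.findGreatest Sep ⌊M⌋₊) :=
    Nat.findGreatest_spec (Nat.zero_le _) h0
  refine ⟨F, hF, log_card_le_of_separated P hmeas hd hε0 hε1 F hF hsep, fun h hh => ?_⟩
  by_contra! hfar
  have hsymm : ∀ f g, disagree P f g = disagree P g f := fun f g => by
    unfold disagree; simp_rw [ne_comm]
  have hnot : h ∉ F := fun hmem => by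
    have := hfar h hmem
    simp only [disagree, ne_eq, not_true_eq_false] at this
    simp at this
    linarith
  have hbig : Sep (F.card + 1) := by
    refine ⟨insert h F, Finset.card_insert_of_notMem hnot, ?_, ?_⟩
    · rw [Finset.forall_mem_insert]
      exact ⟨hh, hF⟩
    · intro f hf g hg hfg
      rcases Finset.mem_insert.1 hf with rfl | hf' <;> rcases Finset.mem_insert.1 hg with rfl | hg'
      · exact absurd rfl hfg
      · exact (hfar g hg').le
      · rw [hsymm]; exact (hfar f hf').le
      · exact hsep f hf' g hg' hfg
  have := Nat.le_findGreatest (hbound _ hbig) hbig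
  omega

end BinaryClass

namespace BinaryClass

/-! ### The error under a relabelling as a linear statistic of the labels -/

section Relabel

variable {X : Type*} [MeasurableSpace X] {k : ℕ} (D : Measure (X × Fin k))

/-- The signed mass `E_{(x, y) ∼ D} [h(x) 𝟙(y = i)]` that `h` puts on the label `i`. -/
noncomputable def labelWeight (h : X → ℤˣ) (i : Fin k) : ℝ :=
  D.real {z | z.2 = i ∧ h z.1 = 1} - D.real {z | z.2 = i ∧ h z.1 = -1}

/-- The centred statistic `∑ i, (p - 𝟙[φ i = -1]) * labelWeight D h i`: how far, at most, the error
of `h` under the relabelling `φ` can fall below `p`. -/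
noncomputable def deficit (p : ℝ) (h : X → ℤˣ) (φ : Fin k → ℤˣ) : ℝ :=
  ∑ i, -labelWeight D h i * (labelInd (-1) φ i - p)

lemma measurableSet_label_and {A : Set (X × Fin k)} (hA : MeasurableSet A) (i : Fin k) :
    MeasurableSet {z : X × Fin k | z.2 = i ∧ z ∈ A} :=
  (measurable_snd (MeasurableSet.singleton i)).inter hA

lemma measurableSet_fst_eq {h : X → ℤˣ} (hh : Measurable h) (u : ℤˣ) :
    MeasurableSet {z : X × Fin k | h z.1 = u} :=
  (hh.comp measurable_fst) (MeasurableSet.singleton u)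

lemma measurableSet_fst_ne {h g : X → ℤˣ} (hh : Measurable h) (hg : Measurable g) :
    MeasurableSet {x | h x ≠ g x} :=
  (measurableSet_eq_fun hh hg).compl

lemma deficit_sub_deficit (p : ℝ) (h g : X → ℤˣ) (φ : Fin k → ℤˣ) :
    deficit D p h φ - deficit D p g φ
      = ∑ i, (labelWeight D g i - labelWeight D h i) * (labelInd (-1) φ i - p) := by
  rw [deficit, deficit, ← Finset.sum_sub_distrib]
  exact Finset.sum_congr rfl fun i _ => by ring

lemma err_relabel {h : X → ℤˣ} (hh : Measurable h) (φ : Fin k → ℤˣ) :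
    err (relabel D φ) h = D.real {z | h z.1 ≠ φ z.2} := by
  have hφ : Measurable φ := Measurable.of_discrete
  have hA : MeasurableSet {w : X × ℤˣ | h w.1 ≠ w.2} :=
    measurableSet_fst_ne (hh.comp measurable_fst) measurable_snd
  have hm : Measurable fun z : X × Fin k => (z.1, φ z.2) :=
    measurable_fst.prodMk (hφ.comp measurable_snd)
  unfold err relabel
  rw [map_measureReal_apply hm hA]
  rfl

variable [IsProbabilityMeasure D]

lemma sum_measureReal_label {A : Set (X × Fin k)} (hA : MeasurableSet A) :
    ∑ i, D.real {z | z.2 = i ∧ z ∈ A} = D.real A := by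
  rw [← measureReal_biUnion_finset]
  · congr 1
    ext z
    simp
  · intro i _ j _ hij
    refine Set.disjoint_left.2 fun z hz hz' => hij (hz.1.symm.trans hz'.1)
  · exact fun i _ => measurableSet_label_and hA i

lemma label_add_label {h : X → ℤˣ} (hh : Measurable h) (i : Fin k) :
    D.real {z | z.2 = i ∧ h z.1 = 1} + D.real {z | z.2 = i ∧ h z.1 = -1}
      = D.real {z | z.2 = i} := by
  rw [← measureReal_union]
  · congr 1
    ext z
    have := Int.units_eq_one_or (h z.1)
    simp only [Set.mem_union, Set.mem_ofPred_eq]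
    tauto
  · refine Set.disjoint_left.2 fun z hz hz' => ?_
    have := hz.2.symm.trans hz'.2
    revert this
    decide
  · exact measurableSet_label_and (measurableSet_fst_eq hh (-1)) i

lemma sum_label : ∑ i, D.real {z | z.2 = i} = 1 := by
  simpa using sum_measureReal_label D MeasurableSet.univ

/-- Since `p ≤ 1/2`, disagreeing with the labelling costs `h` at least `p` on average. -/
lemma sub_deficit_le_err {h : X → ℤˣ} (hh : Measurable h) (φ : Fin k → ℤˣ) {p : ℝ}
    (hp : p ≤ 1 / 2) : p - deficit D p h φ ≤ err (relabel D φ) h := by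
  have hφ : Measurable φ := Measurable.of_discrete
  have hA : MeasurableSet {z : X × Fin k | h z.1 ≠ φ z.2} :=
    measurableSet_fst_ne (hh.comp measurable_fst) (hφ.comp measurable_snd)
  rw [err_relabel D hh, ← sum_measureReal_label D hA]
  have hp' : p = ∑ i, p * (D.real {z | z.2 = i ∧ h z.1 = 1}
      + D.real {z | z.2 = i ∧ h z.1 = -1}) := by
    rw [← Finset.mul_sum]
    simp_rw [label_add_label D hh]
    rw [sum_label, mul_one]
  nth_rewrite 1 [hp']
  rw [deficit, ← Finset.sum_sub_distrib]
  refine Finset.sum_le_sum fun i _ => ?_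
  have hpos := measureReal_nonneg (μ := D) (s := {z | z.2 = i ∧ h z.1 = -1})
  rcases Int.units_eq_one_or (φ i) with hi | hi
  · have hset : {z : X × Fin k | z.2 = i ∧ z ∈ {z | h z.1 ≠ φ z.2}}
        = {z | z.2 = i ∧ h z.1 = -1} := by
      ext z
      simp only [Set.mem_ofPred_eq]
      refine and_congr_right fun hz => ?_
      rw [hz, hi, Int.units_ne_iff_eq_neg]
    have hind : labelInd (-1) φ i = 0 := by
      unfold labelInd; rw [hi]; exact if_neg (by decide)
    rw [hset, hind, labelWeight]
    nlinarith
  · have hset : {z : X × Fin k | z.2 = i ∧ z ∈ {z | h z.1 ≠ φ z.2}}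
        = {z | z.2 = i ∧ h z.1 = 1} := by
      ext z
      simp only [Set.mem_ofPred_eq]
      refine and_congr_right fun hz => ?_
      rw [hz, hi, Int.units_ne_iff_eq_neg, neg_neg]
    have hind : labelInd (-1) φ i = 1 := by
      unfold labelInd; rw [hi]; exact if_pos rfl
    rw [hset, hind, labelWeight]
    nlinarith

lemma abs_labelWeight_le {h : X → ℤˣ} (hh : Measurable h) (i : Fin k) :
    |labelWeight D h i| ≤ D.real {z | z.2 = i} := by
  rw [← label_add_label D hh, labelWeight, abs_le]
  constructor <;>
    linarith [measureReal_nonneg (μ := D) (s := {z | z.2 = i ∧ h z.1 = -1}),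
      measureReal_nonneg (μ := D) (s := {z | z.2 = i ∧ h z.1 = 1})]

lemma measureReal_label_le_add (h g : X → ℤˣ) (i : Fin k) (u : ℤˣ) :
    D.real {z | z.2 = i ∧ h z.1 = u}
      ≤ D.real {z | z.2 = i ∧ g z.1 = u} + D.real {z | z.2 = i ∧ h z.1 ≠ g z.1} := by
  refine (measureReal_mono ?_).trans (measureReal_union_le _ _)
  rintro z ⟨h1, h2⟩
  by_cases hg : g z.1 = u
  · exact Or.inl ⟨h1, hg⟩
  · exact Or.inr ⟨h1, fun he => hg (he ▸ h2)⟩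

lemma abs_labelWeight_sub_le (h g : X → ℤˣ) (i : Fin k) :
    |labelWeight D h i - labelWeight D g i| ≤ 2 * D.real {z | z.2 = i ∧ h z.1 ≠ g z.1} := by
  have hsymm : {z : X × Fin k | z.2 = i ∧ g z.1 ≠ h z.1} = {z | z.2 = i ∧ h z.1 ≠ g z.1} := by
    simp_rw [ne_comm]
  have h1 := measureReal_label_le_add D h g i 1
  have h2 := measureReal_label_le_add D h g i (-1)
  have h3 := measureReal_label_le_add D g h i 1
  have h4 := measureReal_label_le_add D g h i (-1)
  rw [hsymm] at h3 h4
  unfold labelWeight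
  rw [abs_le]
  constructor <;> linarith

lemma sum_label_ne {h g : X → ℤˣ} (hh : Measurable h) (hg : Measurable g) :
    ∑ i, D.real {z : X × Fin k | z.2 = i ∧ h z.1 ≠ g z.1} = disagree D.fst h g := by
  have h1 := sum_measureReal_label D (A := {z | h z.1 ≠ g z.1})
    (measurableSet_fst_ne (hh.comp measurable_fst) (hg.comp measurable_fst))
  refine h1.trans ?_
  rw [disagree, Measure.fst, map_measureReal_apply measurable_fst (measurableSet_fst_ne hh hg)]
  rfl

lemma sum_labelWeight_sq_le {b : ℝ} (hD : ∀ i : Fin k, D.real {z | z.2 = i} ≤ b)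
    {h : X → ℤˣ} (hh : Measurable h) : ∑ i, (-labelWeight D h i) ^ 2 ≤ b := by
  calc ∑ i, (-labelWeight D h i) ^ 2 ≤ ∑ i, b * D.real {z | z.2 = i} := by
        refine Finset.sum_le_sum fun i _ => ?_
        have h1 := abs_labelWeight_le D hh i
        rw [neg_sq, ← sq_abs, sq]
        exact mul_le_mul (h1.trans (hD i)) h1 (abs_nonneg _)
          (measureReal_nonneg.trans (hD i))
    _ = b := by rw [← Finset.mul_sum, sum_label, mul_one]

lemma sum_labelWeight_sub_sq_le {b : ℝ} (hD : ∀ i : Fin k, D.real {z | z.2 = i} ≤ b)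
    {h g : X → ℤˣ} (hh : Measurable h) (hg : Measurable g) :
    ∑ i, (labelWeight D g i - labelWeight D h i) ^ 2 ≤ 4 * b * disagree D.fst h g := by
  rw [← sum_label_ne D hh hg, Finset.mul_sum]
  refine Finset.sum_le_sum fun i _ => ?_
  have h1 := abs_labelWeight_sub_le D h g i
  have h2 : D.real {z | z.2 = i ∧ h z.1 ≠ g z.1} ≤ b :=
    (measureReal_mono fun z hz => hz.1).trans (hD i)
  have h0 := measureReal_nonneg (μ := D) (s := {z | z.2 = i ∧ h z.1 ≠ g z.1})
  rw [← sq_abs, abs_sub_comm]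
  calc _ ≤ (2 * D.real {z | z.2 = i ∧ h z.1 ≠ g z.1}) ^ 2 :=
        pow_le_pow_left₀ (abs_nonneg _) h1 2
    _ ≤ _ := by nlinarith

lemma deficit_sub_deficit_le {p : ℝ} (hp0 : 0 ≤ p) (hp1 : p ≤ 1) {h g : X → ℤˣ}
    (hh : Measurable h) (hg : Measurable g) (φ : Fin k → ℤˣ) :
    deficit D p h φ - deficit D p g φ ≤ 2 * disagree D.fst h g := by
  rw [deficit_sub_deficit, ← sum_label_ne D hh hg, Finset.mul_sum]
  refine Finset.sum_le_sum fun i _ => ?_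
  have h1 := abs_labelWeight_sub_le D h g i
  have h2 : |labelInd (-1) φ i - p| ≤ 1 := by
    unfold labelInd
    rw [abs_le]
    split_ifs <;> constructor <;> linarith
  calc _ ≤ |(labelWeight D g i - labelWeight D h i) * (labelInd (-1) φ i - p)| := le_abs_self _
    _ ≤ |labelWeight D g i - labelWeight D h i| * 1 := by
        rw [abs_mul]; gcongr
    _ ≤ _ := by rw [mul_one, abs_sub_comm]; exact h1

/-! ### Chaining -/

variable {P : Measure (Fin k → ℤˣ)} [IsProbabilityMeasure P] {p : ℝ}

lemma measureReal_deficit_le (hP : NegDependent P p) (hk : (0 : ℝ) < k)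
    (hD : ∀ i : Fin k, D.real {z | z.2 = i} ≤ 10 / (k : ℝ)) {h : X → ℤˣ} (hh : Measurable h)
    {t : ℝ} (ht : 0 ≤ t) :
    P.real {φ | t ≤ deficit D p h φ} ≤ Real.exp (-(t ^ 2 * k / 20)) := by
  refine (hP.measureReal_le_sum _ (by positivity) (sum_labelWeight_sq_le D hD hh) ht).trans_eq ?_
  congr 2
  field_simp
  ring

lemma measureReal_deficit_sub_le (hP : NegDependent P p) (hk : (0 : ℝ) < k)
    (hD : ∀ i : Fin k, D.real {z | z.2 = i} ≤ 10 / (k : ℝ)) {h g : X → ℤˣ} (hh : Measurable h)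
    (hg : Measurable g) {r t : ℝ} (hr : 0 < r) (hhg : disagree D.fst h g ≤ r) (ht : 0 ≤ t) :
    P.real {φ | t ≤ deficit D p h φ - deficit D p g φ} ≤ Real.exp (-(t ^ 2 * k / (80 * r))) := by
  simp_rw [deficit_sub_deficit]
  refine (hP.measureReal_le_sum (v := 4 * (10 / k) * r) _ (by positivity)
    ((sum_labelWeight_sub_sq_le D hD hh hg).trans (by gcongr)) ht).trans_eq ?_
  congr 2
  field_simp
  ring

end Relabel

/-- The cost of the union bound at the `j`-th level of the chain, where the net has at most
`exp (1/2) * 4 ^ (2 d (j + 1))` elements and each of them fails with probability at most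
`exp (-6 (d + log (1/δ)) (j + 1) ^ 2)`. -/
lemma card_mul_exp_le {d N j : ℕ} (hd : 1 ≤ d) {δ E : ℝ} (hδ0 : 0 < δ) (hδ1 : δ ≤ 1)
    (hN : Real.log N ≤ 1 / 2 + 2 * d * Real.log (4 / (1 / 4) ^ j))
    (hE : 6 * (d + Real.log (1 / δ)) * ((j : ℝ) + 1) ^ 2 ≤ E) :
    (N : ℝ) * Real.exp (-E) ≤ δ * (1 / 2) ^ (j + 1) := by
  rcases Nat.eq_zero_or_pos N with rfl | hNpos
  · simp; positivity
  have hN0 : (0 : ℝ) < N := by exact_mod_cast hNpos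
  have hL : 0 ≤ Real.log (1 / δ) := Real.log_nonneg (by rw [le_div_iff₀ hδ0]; linarith)
  have hlog : Real.log (4 / (1 / 4) ^ j) = 2 * (j + 1) * Real.log 2 := by
    have : (4 : ℝ) / (1 / 4) ^ j = 2 ^ (2 * (j + 1)) := by
      rw [pow_mul, one_div, inv_pow, div_inv_eq_mul]
      norm_num [pow_succ]
      ring
    rw [this, Real.log_pow]
    push_cast
    ring
  have hl2 := Real.log_two_lt_d9
  have hd' : (1 : ℝ) ≤ d := by exact_mod_cast hd
  have hj : (1 : ℝ) ≤ (j : ℝ) + 1 := by linarith [Nat.cast_nonneg (α := ℝ) j]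
  have hrhs : δ * (1 / 2) ^ (j + 1)
      = Real.exp (-Real.log (1 / δ) - (j + 1) * Real.log 2) := by
    rw [sub_eq_add_neg, Real.exp_add, one_div δ, Real.log_inv, neg_neg, Real.exp_log hδ0,
      Real.exp_neg, ← Nat.cast_succ, ← Real.log_pow, Real.exp_log (by positivity), one_div,
      inv_pow]
  rw [hrhs]
  nth_rewrite 1 [← Real.exp_log hN0]
  rw [← Real.exp_add, Real.exp_le_exp]
  rw [hlog] at hN
  set n : ℝ := (j : ℝ) + 1
  set L := Real.log (1 / δ)
  have hdn : 1 ≤ d * n := by nlinarith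
  have h1 : n ≤ d * n := by nlinarith
  have h2 : 2 * d * (2 * n * Real.log 2) ≤ 2.8 * (d * n) := by nlinarith
  have h3 : d * n ≤ d * n ^ 2 := by nlinarith
  have h4 : L ≤ L * n ^ 2 := le_mul_of_one_le_right hL (one_le_pow₀ hj)
  have h5 : n * Real.log 2 ≤ 0.7 * n := by nlinarith
  nlinarith

/-- Chaining along nets at the scales `4 ^ (-j)`: with probability at least
`1 - δ (1 - 2 ^ (-(j + 1)))` no member of the `j`-th net has a deficit above
`(ν / 8) ∑_{i ≤ j} (i + 1) 2 ^ (-i)`, a sum equal to `4 - (j + 3) 2 ^ (-j)`. -/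
lemma measureReal_exists_net_le {X : Type*} [MeasurableSpace X] {k : ℕ} (D : Measure (X × Fin k))
    [IsProbabilityMeasure D] {P : Measure (Fin k → ℤˣ)} [IsProbabilityMeasure P] {p : ℝ}
    (hP : NegDependent P p) (hk : (0 : ℝ) < k)
    (hD : ∀ i : Fin k, D.real {z | z.2 = i} ≤ 10 / (k : ℝ))
    {H : Set (X → ℤˣ)} (hmeas : ∀ h ∈ H, Measurable h) {d : ℕ} (hd : 1 ≤ d)
    {ν δ : ℝ} (hν : 0 < ν) (hδ0 : 0 < δ) (hδ1 : δ ≤ 1)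
    (hkd : 122880 * (d + Real.log (1 / δ)) ≤ ν ^ 2 * k)
    (T : ℕ → Finset (X → ℤˣ)) (hTH : ∀ j, ∀ f ∈ T j, f ∈ H)
    (hcard : ∀ j, Real.log (T j).card ≤ 1 / 2 + 2 * d * Real.log (4 / (1 / 4) ^ j))
    (hnet : ∀ j, ∀ h ∈ H, ∃ f ∈ T j, disagree D.fst h f ≤ (1 / 4) ^ j) (j : ℕ) :
    P.real {φ | ∃ g ∈ T j, ν / 8 * (4 - (j + 3) * (1 / 2) ^ j) < deficit D p g φ}
      ≤ δ * (1 - (1 / 2) ^ (j + 1)) := by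
  have hL : 0 ≤ Real.log (1 / δ) := Real.log_nonneg (by rw [le_div_iff₀ hδ0]; linarith)
  induction j with
  | zero =>
    have hsub : {φ | ∃ g ∈ T 0, ν / 8 * (4 - ((0 : ℕ) + 3) * (1 / 2) ^ 0) < deficit D p g φ}
        ⊆ ⋃ g ∈ T 0, {φ | ν / 8 ≤ deficit D p g φ} := by
      rintro φ ⟨g, hg, hlt⟩
      refine Set.mem_biUnion hg ?_
      norm_num at hlt
      exact hlt.le.trans' (by linarith)
    calc _ ≤ P.real (⋃ g ∈ T 0, {φ | ν / 8 ≤ deficit D p g φ}) :=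
          measureReal_mono hsub (measure_ne_top _ _)
      _ ≤ ∑ g ∈ T 0, P.real {φ | ν / 8 ≤ deficit D p g φ} := measureReal_biUnion_finset_le _ _
      _ ≤ ∑ _g ∈ T 0, Real.exp (-((ν / 8) ^ 2 * k / 20)) :=
          Finset.sum_le_sum fun g hg => measureReal_deficit_le D hP hk hD
            (hmeas g (hTH 0 g hg)) (by positivity)
      _ = (T 0).card * Real.exp (-((ν / 8) ^ 2 * k / 20)) := by
          rw [Finset.sum_const, nsmul_eq_mul]
      _ ≤ δ * (1 / 2) ^ (0 + 1) := by
          refine card_mul_exp_le hd hδ0 hδ1 (hcard 0) ?_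
          have hd0 : (0 : ℝ) ≤ d := Nat.cast_nonneg d
          rw [Nat.cast_zero, zero_add, one_pow, mul_one, div_pow]
          linarith
      _ = _ := by norm_num
  | succ j ih =>
    choose! π hπT hπ using hnet j
    set t := ν / 8 * ((j + 2) * (1 / 2) ^ (j + 1))
    have hsub : {φ | ∃ g ∈ T (j + 1),
          ν / 8 * (4 - ((j + 1 : ℕ) + 3) * (1 / 2) ^ (j + 1)) < deficit D p g φ}
        ⊆ {φ | ∃ g ∈ T j, ν / 8 * (4 - (j + 3) * (1 / 2) ^ j) < deficit D p g φ} ∪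
          ⋃ g ∈ T (j + 1), {φ | t ≤ deficit D p g φ - deficit D p (π g) φ} := by
      rintro φ ⟨g, hg, hlt⟩
      by_cases hπg : ν / 8 * (4 - (j + 3) * (1 / 2) ^ j) < deficit D p (π g) φ
      · exact Or.inl ⟨π g, hπT g (hTH _ g hg), hπg⟩
      · refine Or.inr (Set.mem_biUnion hg ?_)
        have hstep : ν / 8 * (4 - ((j + 1 : ℕ) + 3) * (1 / 2) ^ (j + 1))
            = ν / 8 * (4 - (j + 3) * (1 / 2) ^ j) + t := by
          simp only [t]
          push_cast
          ring
        rw [hstep] at hlt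
        simp only [Set.mem_ofPred_eq]
        linarith
    have hlink : ∑ g ∈ T (j + 1), P.real {φ | t ≤ deficit D p g φ - deficit D p (π g) φ}
        ≤ δ * (1 / 2) ^ (j + 1 + 1) := by
      calc _ ≤ ∑ _g ∈ T (j + 1), Real.exp (-(t ^ 2 * k / (80 * (1 / 4) ^ j))) :=
            Finset.sum_le_sum fun g hg => measureReal_deficit_sub_le D hP hk hD
              (hmeas g (hTH _ g hg)) (hmeas _ (hTH _ _ (hπT g (hTH _ g hg)))) (by positivity)
              (hπ g (hTH _ g hg)) (by positivity)
        _ = (T (j + 1)).card * Real.exp (-(t ^ 2 * k / (80 * (1 / 4) ^ j))) := by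
            rw [Finset.sum_const, nsmul_eq_mul]
        _ ≤ _ := by
            refine card_mul_exp_le hd hδ0 hδ1 (hcard (j + 1)) ?_
            have h4 : (((1 : ℝ) / 2) ^ (j + 1)) ^ 2 = (1 / 4) ^ j * (1 / 4) := by
              rw [pow_right_comm, ← pow_succ]
              norm_num
            have ht : t ^ 2 * k / (80 * (1 / 4) ^ j) = ν ^ 2 * k / 20480 * (j + 2) ^ 2 := by
              simp only [t]
              rw [mul_pow, mul_pow, h4]
              field_simp
              ring
            rw [ht]
            push_cast
            rw [show (j : ℝ) + 1 + 1 = j + 2 by ring]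
            refine mul_le_mul_of_nonneg_right ?_ (by positivity)
            linarith
    calc _ ≤ _ := (measureReal_mono hsub (measure_ne_top _ _)).trans (measureReal_union_le _ _)
      _ ≤ δ * (1 - (1 / 2) ^ (j + 1)) + δ * (1 / 2) ^ (j + 1 + 1) :=
          add_le_add ih ((measureReal_biUnion_finset_le _ _).trans hlink)
      _ = _ := by ring

/-- All hypotheses of a class of VC dimension `0` are equal. -/
lemma eq_of_forall_shatters_card_eq_zero {X : Type*} {H : Set (X → ℤˣ)}
    (hd : ∀ s : Finset X, Shatters H s → s.card ≤ 0) {f g : X → ℤˣ} (hf : f ∈ H) (hg : g ∈ H) :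
    f = g := by
  by_contra hne
  obtain ⟨x, hx⟩ := Function.ne_iff.1 hne
  have := hd {x} fun φ => by
    by_cases hfx : f x = φ x
    · exact ⟨f, hf, by simpa using hfx⟩
    · refine ⟨g, hg, ?_⟩
      have h1 := Int.units_ne_iff_eq_neg.1 hfx
      have h2 := Int.units_ne_iff_eq_neg.1 hx
      simp only [Finset.mem_singleton, forall_eq]
      rw [h1] at h2
      exact (neg_injective h2).symm
  simp at this

/-- The uniform lower bound on the error, for any negatively dependent random labelling. -/
lemma one_sub_le_measureReal_approxErr {X : Type*} [MeasurableSpace X] {k : ℕ}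
    (D : Measure (X × Fin k)) [IsProbabilityMeasure D] {P : Measure (Fin k → ℤˣ)}
    [IsProbabilityMeasure P] {p : ℝ} (hP : NegDependent P p) (hp : p ≤ 1 / 2)
    (hk : (0 : ℝ) < k) (hD : ∀ i : Fin k, D.real {z | z.2 = i} ≤ 10 / (k : ℝ))
    {H : Set (X → ℤˣ)} (hmeas : ∀ h ∈ H, Measurable h) {d : ℕ} (hVC : HasVCDim H d)
    {ν δ : ℝ} (hν : 0 < ν) (hδ0 : 0 < δ) (hkd : 122880 * ((d + Real.log (1 / δ)) / ν ^ 2) ≤ k) :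
    1 - δ ≤ P.real {φ | p - ν ≤ approxErr (relabel D φ) H} := by
  rcases le_or_gt 1 δ with hδ1 | hδ1
  · exact (sub_nonpos.2 hδ1).trans measureReal_nonneg
  have hL : 0 ≤ Real.log (1 / δ) := Real.log_nonneg (by rw [le_div_iff₀ hδ0]; linarith)
  replace hkd : 122880 * (d + Real.log (1 / δ)) ≤ ν ^ 2 * k := by
    rw [← mul_div_assoc, div_le_iff₀ (by positivity)] at hkd
    linarith
  have hd : ∀ s : Finset X, Shatters H s → s.card ≤ d := fun s hs => hVC.2 ⟨s, rfl, hs⟩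
  obtain ⟨⟨s, _, hs⟩, _⟩ := hVC
  obtain ⟨h₀, hh₀, _⟩ := hs 1
  have : Nonempty H := ⟨⟨h₀, hh₀⟩⟩
  -- It suffices that every deficit exceeds `ν` only on an event of probability at most `δ`.
  suffices hB : ∃ B : Set (Fin k → ℤˣ), P.real B ≤ δ ∧
      ∀ φ ∉ B, ∀ h ∈ H, deficit D p h φ ≤ ν by
    obtain ⟨B, hBδ, hB⟩ := hB
    have hc := probReal_compl_eq_one_sub (μ := P) (s := B) (MeasurableSet.of_discrete)
    have hmono : P.real Bᶜ ≤ P.real {φ | p - ν ≤ approxErr (relabel D φ) H} := by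
      refine measureReal_mono fun φ hφ => ?_
      rw [Set.mem_ofPred_eq]
      refine le_ciInf fun h => ?_
      linarith [hB φ hφ h h.2, sub_deficit_le_err D (hmeas h h.2) φ hp]
    linarith
  rcases Nat.eq_zero_or_pos d with rfl | hdpos
  · refine ⟨{φ | ν ≤ deficit D p h₀ φ}, ?_, fun φ hφ h hh => ?_⟩
    · refine (measureReal_deficit_le D hP hk hD (hmeas h₀ hh₀) hν.le).trans ?_
      rw [← Real.le_log_iff_exp_le hδ0]
      rw [one_div, Real.log_inv] at hkd hL
      push_cast at hkd
      linarith
    · rw [eq_of_forall_shatters_card_eq_zero hd hh hh₀]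
      exact (not_le.1 hφ).le
  · have hex : ∀ j : ℕ, ∃ F : Finset (X → ℤˣ), (∀ f ∈ F, f ∈ H) ∧
        Real.log F.card ≤ 1 / 2 + 2 * d * Real.log (4 / (1 / 4) ^ j) ∧
        ∀ h ∈ H, ∃ f ∈ F, disagree D.fst h f ≤ (1 / 4) ^ j := fun j =>
      exists_net D.fst hmeas hd (by positivity) (pow_le_one₀ (by norm_num) (by norm_num))
    choose T hTH hcard hnet using hex
    obtain ⟨J, hJ⟩ := exists_pow_lt_of_lt_one (show (0 : ℝ) < ν / 4 by positivity)
      (show (1 / 4 : ℝ) < 1 by norm_num)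
    refine ⟨_, (measureReal_exists_net_le D hP hk hD hmeas hdpos hν hδ0 hδ1.le hkd T hTH hcard
      hnet J).trans (mul_le_of_le_one_right hδ0.le (sub_le_self _ (by positivity))),
      fun φ hφ h hh => ?_⟩
    obtain ⟨g, hg, hhg⟩ := hnet J h hh
    have hgφ : deficit D p g φ ≤ ν / 8 * (4 - (J + 3) * (1 / 2) ^ J) := by
      by_contra! hlt
      exact hφ ⟨g, hg, hlt⟩
    have hgν : ν / 8 * (4 - (J + 3) * (1 / 2) ^ J) ≤ ν / 8 * 4 := by
      gcongr
      exact sub_le_self _ (by positivity)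
    have := deficit_sub_deficit_le D hP.nonneg hP.le_one (hmeas h hh) (hmeas g (hTH J g hg)) φ
    linarith

end BinaryClass

/-! ### The two sampling rules -/

theorem lemma9 :
    ∃ C : ℝ, 0 < C ∧
      ∀ (X : Type*) [MeasurableSpace X] (H : Set (X → ℤˣ)) (d : ℕ),
        (∀ h ∈ H, Measurable h) →
        BinaryClass.HasVCDim H d →
        ∀ μ : unitInterval, 0 < (μ : ℝ) → (μ : ℝ) ≤ 1 / 2 →
        ∀ (k : ℕ) (D : Measure (X × Fin k)) [IsProbabilityMeasure D],
        (∀ i : Fin k, D.real {z | z.2 = i} ≤ 10 / (k : ℝ)) →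
        ∀ ν δ : ℝ, 0 < ν → 0 < δ →
        C * (((d : ℝ) + Real.log (1 / δ)) / ν ^ 2) ≤ (k : ℝ) →
          1 - δ ≤ (BinaryClass.iidLabeling k μ).real
              {φ | (μ : ℝ) - ν ≤ BinaryClass.approxErr (BinaryClass.relabel D φ) H} ∧
          ((∃ j : ℕ, (j : ℝ) = (μ : ℝ) * k) →
            1 - δ ≤ (BinaryClass.balancedLabeling k μ).real
              {φ | (μ : ℝ) - ν ≤ BinaryClass.approxErr (BinaryClass.relabel D φ) H}) := by
  refine ⟨122880, by norm_num, ?_⟩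
  intro X _ H d hmeas hVC μ _ hμ k D _ hD ν δ hν hδ hkd
  -- `k = 0` is impossible, since `D` has mass `1` on `X × Fin k`.
  have hk : 0 < k := by
    obtain ⟨z⟩ := nonempty_of_isProbabilityMeasure D
    exact z.2.pos
  have hk' : (0 : ℝ) < k := by exact_mod_cast hk
  refine ⟨BinaryClass.one_sub_le_measureReal_approxErr D
    (BinaryClass.negDependent_iidLabeling k μ) hμ hk' hD hmeas hVC hν hδ hkd, ?_⟩
  rintro ⟨j, hj⟩
  have := BinaryClass.isProbabilityMeasure_balancedLabeling hj
  exact BinaryClass.one_sub_le_measureReal_approxErr D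
    (BinaryClass.negDependent_balancedLabeling hk hj) hμ hk' hD hmeas hVC hν hδ hkd
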